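/- **Setting.** Write $[n]=\{1,\dots,n\}$. A Markov chain on $[n]$ is identified with its transition matrix $P\in\mathbb R^{n\times n}$ (nonnegative entries, rows summing to $1$); it is reversible with uniform invariant measure if $\nu P=\nu$ and $\nu(x)P(x,y)=\nu(y)P(y,x)$ for all $x,y$, where $\nu\equiv 1/n$. Let $\langle f,g\rangle_\nu=\frac1n\sum_x f(x)g(x)$. Every $M\in\mathbb R^{n\times n}$ has a singular value decomposition $M(x,y)=\sum_{i=1}^n\sigma_i\,\psi_i(x)\,\phi_i(y)\,\nu(y)$ with $\sigma_1\ge\dots\ge\sigma_n\ge0$ and $(\psi_i)_i$, $(\phi_i)_i$ orthonormal bases for $\langle\cdot,\cdot\rangle_\nu$, and its spectral recoverability is $\xi(M)=\max_x\sum_i\sigma_i\psi_i(x)^2$ (independent of the choice of the decomposition). Let $\|A\|_{\infty,\infty}=\sup_{f\neq0}\|Af\|_\infty/\|f\|_\infty$. Given $Z\in\mathbb N^n$, for each $x\in[n]$ one observes $Z_x$ transitions from $x$, with endpoints drawn from $P(x,\cdot)$, all transitions being independent; $\mathbb P_P$ is the law of this sample. For a set $\mathcal P$ of transition matrices, an estimator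 $\widehat P$ (a matrix-valued function of the sample) is $(\varepsilon,\delta)$-PAC for $\mathcal P$ and $\|\cdot\|_{\infty,\infty}$ if $\mathbb P_P\big[\|\widehat P-P\|_{\infty,\infty}>\varepsilon\big]\le\delta$ for all $P\in\mathcal P$. **Theorem.** There is a universal constant $C>0$ such that for every sufficiently large integer $n$ and every real $\kappa\in[1,n]$ there exists a family $\mathcal P_\kappa$ of Markov chains on $[n]$ with the following properties: (i) every $P\in\mathcal P_\kappa$ is reversible with uniform invariant measure; (ii) $\xi(P)\le\kappa$ for every $P\in\mathcal P_\kappa$; (iii) for every $\varepsilon\in(0,1/3)$ with $3\varepsilon\le\kappa-1$ (the second condition is automatic when $\kappa\ge2$), every $\delta\in[0,1/2]$ and every $Z\in\mathbb N^n$ with $\sum_{x\in[n]}Z_x\le C\,\varepsilon^{-2}\max(n,\kappa^2)$, there exists no $(\varepsilon,\delta)$-PAC estimator for $\mathcal P_\kappa$ and the norm $\|\cdot\|_{\infty,\infty}$ based on a sample with counts $Z$. -/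

import Mathlib

/-- The uniform probability measure on `Fin n`, as a weight function. -/
noncomputable def uniformWeight (n : ℕ) : Fin n → ℝ := fun _ => 1 / (n : ℝ)

/-- A singular value decomposition of `M` with respect to the weight `ν`, that is
`M = ∑ i, σ i • ψ i (φ i)†`, where `f† x = ν x * f x`, the `σ i` are nonnegative and in nonincreasing
order, and `ψ` and `φ` are orthonormal bases for `⟪f, g⟫_ν = ∑ x, ν x * f x * g x`. -/
structure WeightedSVD {n : ℕ} (ν : Fin n → ℝ) (M : Matrix (Fin n) (Fin n) ℝ) where
  /-- singular values -/
  σ : Fin n → ℝ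
  /-- left singular vectors -/
  ψ : Fin n → Fin n → ℝ
  /-- right singular vectors -/
  φ : Fin n → Fin n → ℝ
  σ_nonneg : ∀ i, 0 ≤ σ i
  σ_antitone : Antitone σ
  ψ_orthonormal : ∀ i j, ∑ x, ν x * ψ i x * ψ j x = if i = j then 1 else 0
  φ_orthonormal : ∀ i j, ∑ x, ν x * φ i x * φ j x = if i = j then 1 else 0
  eq_sum : ∀ x y, M x y = ∑ i, σ i * ψ i x * (ν y * φ i y)

/-- The quantity `max_x ∑ i, σ i * ψ i x ^ 2` of one singular value decomposition. -/
noncomputable def WeightedSVD.recoverability {n : ℕ} {ν : Fin n → ℝ}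
    {M : Matrix (Fin n) (Fin n) ℝ} (S : WeightedSVD ν M) : ℝ :=
  ⨆ x, ∑ i, S.σ i * S.ψ i x ^ 2

open Classical in
/-- The spectral recoverability `ξ(M) = max_x ∑ i, σ i * ψ i x ^ 2` of `M` with respect to `ν`.
When `ν` is positive, a decomposition exists (`WeightedSVD.nonempty`) and the value does not
depend on it (`spectralRecoverability_eq`). -/
noncomputable def spectralRecoverability {n : ℕ} (ν : Fin n → ℝ)
    (M : Matrix (Fin n) (Fin n) ℝ) : ℝ :=
  if h : Nonempty (WeightedSVD ν M) then h.some.recoverability else 0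

theorem WeightedSVD.nonempty {n : ℕ} {ν : Fin n → ℝ} (hν : ∀ x, 0 < ν x)
    (M : Matrix (Fin n) (Fin n) ℝ) : Nonempty (WeightedSVD ν M) := by
  classical
  let A : Matrix (Fin n) (Fin n) ℝ := fun x y => √(ν x) * M x y / √(ν y)
  let T : EuclideanSpace ℝ (Fin n) →ₗ[ℝ] EuclideanSpace ℝ (Fin n) := Matrix.toLpLin 2 2 A
  have hpos : (LinearMap.adjoint T ∘ₗ T).IsPositive := LinearMap.isPositive_adjoint_comp_self T
  have hT := hpos.isSymmetric
  have hn : Module.finrank ℝ (EuclideanSpace ℝ (Fin n)) = n := by simp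
  let v := hT.eigenvectorBasis hn
  let μ := hT.eigenvalues hn
  have hμ : ∀ i, 0 ≤ μ i := hpos.nonneg_eigenvalues hn
  have hin : ∀ i j, inner ℝ (T (v i)) (T (v j)) = if i = j then μ i else 0 := by
    intro i j
    have h1 : inner ℝ (T (v i)) (T (v j)) = inner ℝ ((LinearMap.adjoint T ∘ₗ T) (v i)) (v j) := by
      simp [LinearMap.adjoint_inner_left]
    rw [h1, hT.apply_eigenvectorBasis hn i, inner_smul_left]
    have := orthonormal_iff_ite.1 v.orthonormal i j
    rw [this]
    simp [μ]
  let w : Fin n → EuclideanSpace ℝ (Fin n) := fun i => (√(μ i))⁻¹ • T (v i)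
  let s : Set (Fin n) := {i | μ i ≠ 0}
  have hw : Orthonormal ℝ (s.domRestrict w) := by
    rw [orthonormal_iff_ite]
    rintro ⟨i, hi⟩ ⟨j, hj⟩
    have hij : inner ℝ (s.domRestrict w ⟨i, hi⟩) (s.domRestrict w ⟨j, hj⟩)
        = (√(μ i))⁻¹ * ((√(μ j))⁻¹ * if i = j then μ i else 0) := by
      rw [← hin i j]
      simp only [Set.domRestrict_apply, w, inner_smul_left, inner_smul_right, conj_trivial]
      ring
    rw [hij]
    simp only [Subtype.mk.injEq]
    split_ifs with h
    · subst h
      have h0 : √(μ i) ≠ 0 := Real.sqrt_ne_zero'.2 (lt_of_le_of_ne (hμ i) (Ne.symm hi))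
      have h2 := Real.mul_self_sqrt (hμ i)
      field_simp
      nlinarith
    · simp
  obtain ⟨b, hb⟩ := hw.exists_orthonormalBasis_extension_of_card_eq (by simp)
  have hTv : ∀ i, T (v i) = √(μ i) • b i := by
    intro i
    by_cases hi : μ i = 0
    · have : T (v i) = 0 := by
        rw [← inner_self_eq_zero (𝕜 := ℝ), hin]; simp [hi]
      simp [this, hi]
    · have h0 : √(μ i) ≠ 0 := Real.sqrt_ne_zero'.2 (lt_of_le_of_ne (hμ i) (Ne.symm hi))
      rw [hb i hi, smul_smul, mul_inv_cancel₀ h0, one_smul]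
  have hs : ∀ x, 0 < √(ν x) := fun x => Real.sqrt_pos.2 (hν x)
  have hss : ∀ x, √(ν x) * √(ν x) = ν x := fun x => Real.mul_self_sqrt (hν x).le
  have key : ∀ x y, A x y = ∑ i, √(μ i) * b i x * v i y := by
    intro x y
    have h1 : T (EuclideanSpace.single y 1) x = A x y := by
      simp [T, Matrix.toLpLin_apply]
    have h2 := v.sum_repr' (EuclideanSpace.single y (1 : ℝ))
    rw [← h1, ← h2, map_sum]
    simp [hTv, EuclideanSpace.inner_single_right]
    exact Finset.sum_congr rfl fun i _ => by ring
  have orth : ∀ (c : OrthonormalBasis (Fin n) ℝ (EuclideanSpace ℝ (Fin n))) (i j : Fin n),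
      ∑ x, ν x * (c i x / √(ν x)) * (c j x / √(ν x)) = if i = j then 1 else 0 := by
    intro c i j
    rw [← orthonormal_iff_ite.1 c.orthonormal i j, PiLp.inner_apply]
    refine Finset.sum_congr rfl fun x _ => ?_
    have := (hs x).ne'
    rw [← hss x]
    simp
    field_simp
  refine ⟨⟨fun i => √(μ i), fun i x => b i x / √(ν x), fun i x => v i x / √(ν x),
    fun i => Real.sqrt_nonneg _, fun i j hij => Real.sqrt_le_sqrt (hT.eigenvalues_antitone hn hij),
    orth b, orth v, fun x y => ?_⟩⟩
  have h3 : M x y = A x y * √(ν y) / √(ν x) := by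
    have := (hs x).ne'
    have := (hs y).ne'
    simp only [A]
    field_simp
  rw [h3, key, Finset.sum_mul, Finset.sum_div]
  refine Finset.sum_congr rfl fun i _ => ?_
  have := (hs x).ne'
  have := (hs y).ne'
  have := hss y
  field_simp
  linear_combination (√(μ i) * b i x * v i y) * this

open scoped MatrixOrder in
theorem WeightedSVD.sum_eq {n : ℕ} {ν : Fin n → ℝ} (hν : ∀ x, 0 < ν x)
    {M : Matrix (Fin n) (Fin n) ℝ} (S S' : WeightedSVD ν M) (x : Fin n) :
    ∑ i, S.σ i * S.ψ i x ^ 2 = ∑ i, S'.σ i * S'.ψ i x ^ 2 := by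
  classical
  have hs : ∀ x, 0 < √(ν x) := fun x => Real.sqrt_pos.2 (hν x)
  have hss : ∀ x, √(ν x) * √(ν x) = ν x := fun x => Real.mul_self_sqrt (hν x).le
  let A : Matrix (Fin n) (Fin n) ℝ := fun x y => √(ν x) * M x y / √(ν y)
  let U : WeightedSVD ν M → Matrix (Fin n) (Fin n) ℝ := fun S x i => √(ν x) * S.ψ i x
  let V : WeightedSVD ν M → Matrix (Fin n) (Fin n) ℝ := fun S x i => √(ν x) * S.φ i x
  let K : WeightedSVD ν M → Matrix (Fin n) (Fin n) ℝ := fun S =>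
    U S * Matrix.diagonal S.σ * (U S).transpose
  have hUa : ∀ S x i, U S x i = √(ν x) * S.ψ i x := fun _ _ _ => rfl
  have hVa : ∀ S x i, V S x i = √(ν x) * S.φ i x := fun _ _ _ => rfl
  have hU : ∀ S, (U S).transpose * U S = 1 := by
    intro S
    ext i j
    rw [Matrix.mul_apply, Matrix.one_apply, ← S.ψ_orthonormal i j]
    refine Finset.sum_congr rfl fun x _ => ?_
    rw [Matrix.transpose_apply, hUa, hUa]
    linear_combination (S.ψ i x * S.ψ j x) * hss x
  have hV : ∀ S, (V S).transpose * V S = 1 := by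
    intro S
    ext i j
    rw [Matrix.mul_apply, Matrix.one_apply, ← S.φ_orthonormal i j]
    refine Finset.sum_congr rfl fun x _ => ?_
    rw [Matrix.transpose_apply, hVa, hVa]
    linear_combination (S.φ i x * S.φ j x) * hss x
  have hA : ∀ S, A = U S * Matrix.diagonal S.σ * (V S).transpose := by
    intro S
    ext x y
    have h1 : A x y = √(ν x) * M x y / √(ν y) := rfl
    rw [h1, Matrix.mul_apply, S.eq_sum, Finset.mul_sum, Finset.sum_div]
    refine Finset.sum_congr rfl fun i _ => ?_
    rw [Matrix.mul_diagonal, Matrix.transpose_apply, hUa, hVa]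
    have := (hs y).ne'
    have := hss y
    field_simp
    linear_combination (-√(ν x) * S.σ i * S.ψ i x * S.φ i y) * this
  have hK : ∀ S, K S * K S = A * A.transpose := by
    intro S
    rw [hA S]
    simp only [K, Matrix.transpose_mul, Matrix.transpose_transpose, Matrix.diagonal_transpose,
      Matrix.mul_assoc]
    rw [← Matrix.mul_assoc (U S).transpose (U S), hU, ← Matrix.mul_assoc (V S).transpose (V S), hV]
  have hpos : ∀ S, 0 ≤ K S := by
    intro S
    rw [Matrix.nonneg_iff_posSemidef]
    have := (Matrix.PosSemidef.diagonal (d := S.σ) (fun i => S.σ_nonneg i)).mul_mul_conjTranspose_same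
      (U S)
    simpa [K, Matrix.conjTranspose_eq_transpose_of_trivial] using this
  have hKK : K S = K S' := by
    have h1 := CFC.sqrt_unique (hK S) (hpos S)
    have h2 := CFC.sqrt_unique (hK S') (hpos S')
    rw [← h1, ← h2]
  have hval : ∀ S : WeightedSVD ν M, K S x x = ν x * ∑ i, S.σ i * S.ψ i x ^ 2 := by
    intro S
    have h1 : K S = U S * Matrix.diagonal S.σ * (U S).transpose := rfl
    rw [h1, Matrix.mul_apply, Finset.mul_sum]
    refine Finset.sum_congr rfl fun i _ => ?_
    rw [Matrix.mul_diagonal, Matrix.transpose_apply, hUa]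
    linear_combination (S.σ i * S.ψ i x ^ 2) * hss x
  have := hval S
  rw [hKK, hval S'] at this
  exact (mul_left_cancel₀ (hν x).ne' this).symm

theorem spectralRecoverability_eq {n : ℕ} {ν : Fin n → ℝ} (hν : ∀ x, 0 < ν x)
    {M : Matrix (Fin n) (Fin n) ℝ} (S : WeightedSVD ν M) :
    spectralRecoverability ν M = ⨆ x, ∑ i, S.σ i * S.ψ i x ^ 2 := by
  unfold spectralRecoverability
  rw [dif_pos ⟨S⟩]
  exact iSup_congr fun x => WeightedSVD.sum_eq hν _ S x

/-- `‖A‖_{∞,∞}`, the operator norm of `A` for the supremum norms. -/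
noncomputable def inftyInftyNorm {n m : ℕ} (A : Matrix (Fin n) (Fin m) ℝ) : ℝ :=
  ‖ContinuousLinearMap.mk (Matrix.mulVecLin A)‖

/-- `ν` is invariant for `P`. -/
def IsInvariantWeight {n : ℕ} (ν : Fin n → ℝ) (P : Matrix (Fin n) (Fin n) ℝ) : Prop :=
  Matrix.vecMul ν P = ν

/-- `P` is reversible with respect to `ν` (detailed balance). -/
def IsReversibleWeight {n : ℕ} (ν : Fin n → ℝ) (P : Matrix (Fin n) (Fin n) ℝ) : Prop :=
  ∀ x y, ν x * P x y = ν y * P y x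

/-- The data of the generative model with `Z x` transitions sampled from each state `x`: the value
at `⟨x, t⟩` is the endpoint of the `t`-th transition that starts in `x`. -/
abbrev TransitionSample {n : ℕ} (m : ℕ) (Z : Fin n → ℕ) : Type :=
  (Σ x : Fin n, Fin (Z x)) → Fin m

/-- The measure `P x ·` on `Fin m`. -/
noncomputable def rowMeasure {n m : ℕ} (P : Matrix (Fin n) (Fin m) ℝ) (x : Fin n) :
    MeasureTheory.Measure (Fin m) :=
  ∑ y, ENNReal.ofReal (P x y) • MeasureTheory.Measure.dirac y

/-- The law of the data under `P`: all transitions are independent, and those which start in `x`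
have law `P x ·`. -/
noncomputable def sampleLaw {n m : ℕ} (P : Matrix (Fin n) (Fin m) ℝ) (Z : Fin n → ℕ) :
    MeasureTheory.Measure (TransitionSample m Z) :=
  MeasureTheory.Measure.pi fun s => rowMeasure P s.1

/-- The estimator `est` of `f P` is `(ε, δ)`-PAC for the class `Pc` and the norm `N`, from `Z x`
transitions out of each state `x`. -/
def IsPACEstimator {n m : ℕ} {E : Type*} [Sub E] (Pc : Set (Matrix (Fin n) (Fin m) ℝ))
    (f : Matrix (Fin n) (Fin m) ℝ → E) (N : E → ℝ) (Z : Fin n → ℕ) (ε δ : ℝ)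
    (est : TransitionSample m Z → E) : Prop :=
  ∀ P ∈ Pc, sampleLaw P Z {ω | ε < N (est ω - f P)} ≤ ENNReal.ofReal δ

/-! The uniform chain is hidden among many perturbations `(1 + 3εB)/n`, where `B` has entries `±1`
(and `0` at a possible unpaired state). States come in pairs with opposite signs, so rows of `B` sum
to zero for any symmetric sign matrix `a` on the `m = ⌊n/2⌋` pairs, and the chain is stochastic and
symmetric.

If one matrix is `ε`-close to two such chains, their sign matrices differ in at most `n/6`, about
`m/3`, places per row (`six_mul_card_le_of_inftyInftyNorm_le`). Random sign rows differ in about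
`m/2` places, so by a Chernoff bound (`card_hamming_ball_le`) any given estimate suits only an
exponentially small fraction `p` of the hypotheses.

Each transition multiplies the second moment of the likelihood ratio against uniform by at most `exp
(9ε²)`. Cauchy–Schwarz (`sq_sum_le_of_chiSq`) then bounds the squared average success probability by
`exp (9ε² ∑ Z) * p`, while a PAC estimator needs at least `1/4`. So `∑ Z` must be of order `ε⁻² log
(1/p)`.

The constraint on `ξ` decides how rich the family can be. If `κ² < 2n`, take `a = uuᵀ`: there are
`m` bits, `log (1/p)` is of order `n`, and positivity gives `ξ ≤ 1 + 3ε ≤ κ`. If `κ² ≥ 2n`, all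
symmetric `a` are allowed, because second moments alone give `ξ ≤ √(2n) ≤ κ`; there are about `m²/2`
bits, and `log (1/p)` is of order `n² ≥ κ²`. -/

/-! ### Law of the sample and success probability of an estimator. -/

/-- The endpoints of the sampled transitions are independent, so the law of the sample charges each
point with the product of its transition probabilities. -/
theorem sampleLaw_real_singleton {n m : ℕ} {P : Matrix (Fin n) (Fin m) ℝ} (hP : ∀ x y, 0 ≤ P x y)
    (Z : Fin n → ℕ) (ω : TransitionSample m Z) :
    (sampleLaw P Z).real {ω} = ∏ s, P s.1 (ω s) := by
  have hfin : ∀ x, MeasureTheory.IsFiniteMeasure (rowMeasure P x) := by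
    intro x
    refine ⟨?_⟩
    simp [rowMeasure, MeasureTheory.Measure.finsetSum_apply]
  rw [MeasureTheory.measureReal_def, sampleLaw, MeasureTheory.Measure.pi_singleton,
    ENNReal.toReal_prod]
  refine Finset.prod_congr rfl fun s _ => ?_
  have : rowMeasure P s.1 {ω s} = ENNReal.ofReal (P s.1 (ω s)) := by
    simp only [rowMeasure, MeasureTheory.Measure.finsetSum_apply, MeasureTheory.Measure.smul_apply,
      smul_eq_mul]
    rw [Finset.sum_eq_single (ω s)]
    · simp
    · intro b _ hb
      simp [hb]
    · simp
  rw [this, ENNReal.toReal_ofReal (hP _ _)]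

theorem isProbabilityMeasure_sampleLaw {n : ℕ} {P : Matrix (Fin n) (Fin n) ℝ}
    (hP : P ∈ Matrix.rowStochastic ℝ (Fin n)) (Z : Fin n → ℕ) :
    MeasureTheory.IsProbabilityMeasure (sampleLaw P Z) := by
  have hrow : ∀ x, MeasureTheory.IsProbabilityMeasure (rowMeasure P x) := by
    intro x
    refine ⟨?_⟩
    simp only [rowMeasure, MeasureTheory.Measure.finsetSum_apply, MeasureTheory.Measure.smul_apply,
      smul_eq_mul, MeasureTheory.measure_univ, mul_one]
    rw [← ENNReal.ofReal_sum_of_nonneg fun y _ => Matrix.nonneg_of_mem_rowStochastic hP,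
      Matrix.sum_row_of_mem_rowStochastic hP, ENNReal.ofReal_one]
  unfold sampleLaw
  infer_instance

/-- A PAC estimator with confidence at least `1/2` is accurate on a set of probability at least
`1/2`. -/
theorem IsPACEstimator.half_le_sum {n : ℕ} {Pc : Set (Matrix (Fin n) (Fin n) ℝ)}
    {N : Matrix (Fin n) (Fin n) ℝ → ℝ} {Z : Fin n → ℕ} {ε δ : ℝ}
    {est : TransitionSample n Z → Matrix (Fin n) (Fin n) ℝ}
    (h : IsPACEstimator Pc id N Z ε δ est) (hδ : δ ≤ 1 / 2) {P : Matrix (Fin n) (Fin n) ℝ}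
    (hPc : P ∈ Pc) (hP : P ∈ Matrix.rowStochastic ℝ (Fin n)) {A : Finset (TransitionSample n Z)}
    (hA : ∀ ω, ω ∈ A ↔ N (est ω - P) ≤ ε) :
    1 / 2 ≤ ∑ ω ∈ A, ∏ s, P s.1 (ω s) := by
  have := isProbabilityMeasure_sampleLaw hP Z
  have hbad : (sampleLaw P Z).real {ω | ε < N (est ω - P)} ≤ 1 / 2 := by
    refine ENNReal.toReal_le_of_le_ofReal (by norm_num) ?_
    exact (h P hPc).trans (ENNReal.ofReal_le_ofReal hδ)
  have hcompl : (A : Set (TransitionSample n Z))ᶜ = {ω | ε < N (est ω - P)} := by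
    ext ω
    simp [hA]
  have hsum : (sampleLaw P Z).real A = ∑ ω ∈ A, ∏ s, P s.1 (ω s) := by
    rw [← MeasureTheory.sum_measureReal_singleton]
    exact Finset.sum_congr rfl fun ω _ =>
      sampleLaw_real_singleton (fun x y => Matrix.nonneg_of_mem_rowStochastic hP) Z ω
  have hadd := MeasureTheory.probReal_compl_eq_one_sub (μ := sampleLaw P Z) A.measurableSet
  rw [hcompl, hsum] at hadd
  linarith

/-! ### The norm as a maximal row sum. -/

theorem inftyInftyNorm_le_iff {n m : ℕ} {A : Matrix (Fin n) (Fin m) ℝ} {c : ℝ} (hc : 0 ≤ c) :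
    inftyInftyNorm A ≤ c ↔ ∀ x, ∑ y, |A x y| ≤ c := by
  let _ := Matrix.linftyOpNormedAddCommGroup (m := Fin n) (n := Fin m) (α := ℝ)
  have h := Matrix.linfty_opNorm_eq_opNorm A
  lift c to NNReal using hc
  rw [inftyInftyNorm, ← h, Matrix.linfty_opNorm_def, NNReal.coe_le_coe, Finset.sup_le_iff]
  refine forall_congr' fun x => ?_
  rw [← NNReal.coe_le_coe]
  simp

theorem sum_abs_sub_le_of_inftyInftyNorm_le {n m : ℕ} {A P Q : Matrix (Fin n) (Fin m) ℝ} {ε : ℝ}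
    (hε : 0 ≤ ε) (hP : inftyInftyNorm (A - P) ≤ ε) (hQ : inftyInftyNorm (A - Q) ≤ ε) (x : Fin n) :
    ∑ y, |P x y - Q x y| ≤ 2 * ε := by
  have h1 := (inftyInftyNorm_le_iff hε).1 hP x
  have h2 := (inftyInftyNorm_le_iff hε).1 hQ x
  have h3 : ∑ y, |P x y - Q x y| ≤ ∑ y, (|(A - P) x y| + |(A - Q) x y|) := by
    refine Finset.sum_le_sum fun y _ => ?_
    have := abs_sub ((A - Q) x y) ((A - P) x y)
    simp only [Matrix.sub_apply] at this ⊢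
    rw [show P x y - Q x y = A x y - Q x y - (A x y - P x y) by ring]
    linarith
  rw [Finset.sum_add_distrib] at h3
  linarith

/-! ### Second-moment Fano inequality and Hamming balls. -/

/-- Second-moment form of Fano's inequality relative to the uniform reference measure: `p` bounds
the fraction of hypotheses that are compatible with a single observation. -/
theorem sq_sum_le_of_chiSq {H ι κ : Type*} [Fintype H] [Fintype ι] [DecidableEq ι] [Fintype κ]
    [Nonempty κ] (W : H → ι → κ → ℝ) (A : H → Finset (ι → κ)) {c p : ℝ}
    (hW : ∀ h i, ∑ y, W h i y ^ 2 ≤ Real.exp c / Fintype.card κ)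
    (hA : ∀ ω, ∀ B : Finset H, (∀ h ∈ B, ω ∈ A h) → (B.card : ℝ) ≤ p * Fintype.card H) :
    (∑ h, ∑ ω ∈ A h, ∏ i, W h i (ω i)) ^ 2 ≤
      Real.exp (c * Fintype.card ι) * p * (Fintype.card H : ℝ) ^ 2 := by
  classical
  have hκ : (0 : ℝ) < Fintype.card κ := by exact_mod_cast Fintype.card_pos
  have hL : ∀ h, ∑ ω : ι → κ, (∏ i, W h i (ω i)) ^ 2 ≤
      (Real.exp c / Fintype.card κ) ^ Fintype.card ι := by
    intro h
    simp_rw [← Finset.prod_pow]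
    rw [← Fintype.prod_sum (fun i y => W h i y ^ 2), ← Finset.card_univ (α := ι),
      ← Finset.prod_const]
    exact Finset.prod_le_prod (fun i _ => Finset.sum_nonneg fun y _ => sq_nonneg _)
      fun i _ => hW h i
  -- Double counting of the pairs `(h, ω)` with `ω ∈ A h`: each `ω` serves at most `p * card H`
  -- hypotheses.
  have hcount : ∑ h, ((A h).card : ℝ) ≤
      (Fintype.card κ : ℝ) ^ Fintype.card ι * (p * Fintype.card H) := by
    have h1 : ∑ h, ((A h).card : ℝ) =
        ∑ ω : ι → κ, ((Finset.univ.filter fun h => ω ∈ A h).card : ℝ) := by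
      simp_rw [Finset.card_eq_sum_ones, Nat.cast_sum, Finset.sum_filter]
      rw [Finset.sum_comm]
      refine Finset.sum_congr rfl fun h _ => ?_
      rw [← Finset.sum_filter]
      simp
    rw [h1]
    refine (Finset.sum_le_sum fun ω _ => hA ω _ fun h hh => (Finset.mem_filter.1 hh).2).trans ?_
    simp
  -- Cauchy–Schwarz of the likelihoods against the indicator of `ω ∈ A h`; the powers of `card κ` in
  -- `hL` and `hcount` cancel.
  have hCS := Finset.sum_mul_sq_le_sq_mul_sq (Finset.univ : Finset (H × (ι → κ)))
    (fun q => ∏ i, W q.1 i (q.2 i)) (fun q => if q.2 ∈ A q.1 then 1 else 0)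
  simp only [Fintype.sum_prod_type, mul_ite, mul_one, mul_zero, ite_pow, one_pow,
    ne_eq, OfNat.ofNat_ne_zero, not_false_eq_true, zero_pow] at hCS
  have e1 : ∀ h, (∑ ω, if ω ∈ A h then ∏ i, W h i (ω i) else 0) =
      ∑ ω ∈ A h, ∏ i, W h i (ω i) := by
    intro h
    rw [← Finset.sum_filter]
    simp
  have e2 : ∀ h, (∑ ω, if ω ∈ A h then (1 : ℝ) else 0) = (A h).card := by
    intro h
    simp
  simp_rw [e1, e2] at hCS
  refine hCS.trans ?_
  calc _ ≤ (Fintype.card H * (Real.exp c / Fintype.card κ) ^ Fintype.card ι) *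
        ((Fintype.card κ : ℝ) ^ Fintype.card ι * (p * Fintype.card H)) := by
        refine mul_le_mul ?_ hcount (by positivity) (by positivity)
        refine (Finset.sum_le_sum fun h _ => hL h).trans ?_
        simp
    _ = _ := by
        rw [mul_comm c, Real.exp_nat_mul, div_pow]
        field_simp

/-- A Chernoff bound for the number of bit strings in a Hamming ball. -/
theorem card_hamming_ball_le {ι : Type*} [Fintype ι] [DecidableEq ι] (h : ι → Bool)
    (B : Finset (ι → Bool)) {t : ℝ}
    (hB : ∀ g ∈ B, ((Finset.univ.filter fun i => g i ≠ h i).card : ℝ) ≤ t) :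
    (B.card : ℝ) ≤ Real.exp (t * (7 / 10) - Fintype.card ι / 4) * Fintype.card (ι → Bool) := by
  -- The tilt `7/10` lies just above `log 2`, so the mean factor per bit is at most `3/4 ≤ exp
  -- (-1/4)`. At a radius of one third of the bits the exponent is `7/30 - 1/4 < 0` per bit.
  have hlog : Real.log 2 ≤ 7 / 10 := by linarith [Real.log_two_lt_d9]
  have h2 : Real.exp (-(7 / 10)) ≤ 1 / 2 := by
    rw [Real.exp_neg, one_div]
    refine inv_anti₀ (by norm_num) ?_
    exact (Real.log_le_iff_le_exp (by norm_num)).1 hlog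
  have hterm : ∀ g ∈ B, (1 : ℝ) ≤
      Real.exp (t * (7 / 10)) * ∏ i, if g i ≠ h i then Real.exp (-(7 / 10)) else 1 := by
    intro g hg
    rw [Finset.prod_ite, Finset.prod_const, Finset.prod_const_one, mul_one, ← Real.exp_nat_mul,
      ← Real.exp_add]
    refine Real.one_le_exp ?_
    have := hB g hg
    linarith
  have hsum : ∑ g : ι → Bool, ∏ i, (if g i ≠ h i then Real.exp (-(7 / 10)) else 1) =
      (1 + Real.exp (-(7 / 10))) ^ Fintype.card ι := by
    rw [← Fintype.prod_sum (fun i b => if b ≠ h i then Real.exp (-(7 / 10)) else 1),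
      ← Finset.card_univ, ← Finset.prod_const]
    refine Finset.prod_congr rfl fun i _ => ?_
    cases h i <;> simp [add_comm]
  have hbase : 1 + Real.exp (-(7 / 10)) ≤ Real.exp (-(1 / 4)) * 2 := by
    have := Real.add_one_le_exp (-(1 / 4) : ℝ)
    linarith
  calc (B.card : ℝ) = ∑ g ∈ B, (1 : ℝ) := by simp
    _ ≤ ∑ g ∈ B, Real.exp (t * (7 / 10)) *
          ∏ i, (if g i ≠ h i then Real.exp (-(7 / 10)) else 1) := Finset.sum_le_sum hterm
    _ ≤ ∑ g : ι → Bool, Real.exp (t * (7 / 10)) *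
          ∏ i, (if g i ≠ h i then Real.exp (-(7 / 10)) else 1) := by
        refine Finset.sum_le_univ_sum_of_nonneg fun g => ?_
        refine mul_nonneg (Real.exp_pos _).le (Finset.prod_nonneg fun i _ => ?_)
        split_ifs <;> positivity
    _ = Real.exp (t * (7 / 10)) * (1 + Real.exp (-(7 / 10))) ^ Fintype.card ι := by
        rw [← Finset.mul_sum, hsum]
    _ ≤ Real.exp (t * (7 / 10)) * (Real.exp (-(1 / 4)) * 2) ^ Fintype.card ι := by
        gcongr
    _ = _ := by
        rw [mul_pow, ← Real.exp_nat_mul, ← mul_assoc, ← Real.exp_add]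
        simp only [Fintype.card_fun, Fintype.card_bool]
        push_cast
        congr 2
        ring

/-! ### Two upper bounds for the spectral recoverability. -/

/-- Entrywise, `ξ(M)` is controlled by the second moments of the rows of `M`. -/
theorem spectralRecoverability_le_of_sum_sq_le {n : ℕ} (hn : 0 < n) {M : Matrix (Fin n) (Fin n) ℝ}
    {c : ℝ} (hc : 0 ≤ c) (hM : ∀ x, n ^ 2 * ∑ y, M x y ^ 2 ≤ c ^ 2) :
    spectralRecoverability (uniformWeight n) M ≤ c := by
  classical
  have hn' : (0 : ℝ) < n := by exact_mod_cast hn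
  have hν : ∀ x, 0 < uniformWeight n x := fun x => by simp only [uniformWeight]; positivity
  have : Nonempty (Fin n) := ⟨⟨0, hn⟩⟩
  obtain ⟨S⟩ := WeightedSVD.nonempty hν M
  rw [spectralRecoverability_eq hν S]
  refine ciSup_le fun x => ?_
  -- The columns of a scaled orthogonal matrix are orthogonal as well as its rows.
  have hψ : ∑ i, S.ψ i x ^ 2 = n := by
    let U : Matrix (Fin n) (Fin n) ℝ := Matrix.of fun i x => S.ψ i x
    have hU : U * ((1 / (n : ℝ)) • U.transpose) = 1 := by
      ext i j
      rw [Matrix.mul_apply, Matrix.one_apply, ← S.ψ_orthonormal i j]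
      refine Finset.sum_congr rfl fun x _ => ?_
      simp only [Matrix.smul_apply, Matrix.transpose_apply, Matrix.of_apply, smul_eq_mul, uniformWeight, U]
      ring
    have h0 := mul_eq_one_comm.1 hU
    have h1 := congrFun (congrFun h0 x) x
    rw [Matrix.mul_apply, Matrix.one_apply_eq] at h1
    simp only [Matrix.smul_apply, Matrix.transpose_apply, Matrix.of_apply, smul_eq_mul, U, mul_assoc, ← pow_two]
      at h1
    rw [← Finset.mul_sum] at h1
    field_simp at h1
    exact h1
  -- Parseval for row `x` of `M` in the basis `φ`.
  have hσ : ∑ i, (S.σ i * S.ψ i x) ^ 2 = n * ∑ y, M x y ^ 2 := by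
    have h1 : ∀ y, n * M x y ^ 2 = ∑ i, ∑ j, (S.σ i * S.ψ i x) * (S.σ j * S.ψ j x) *
        (uniformWeight n y * S.φ i y * S.φ j y) := by
      intro y
      rw [S.eq_sum, pow_two, Finset.sum_mul_sum, Finset.mul_sum]
      refine Finset.sum_congr rfl fun i _ => ?_
      rw [Finset.mul_sum]
      refine Finset.sum_congr rfl fun j _ => ?_
      simp only [uniformWeight]
      field_simp
    rw [Finset.mul_sum]
    simp_rw [h1]
    rw [Finset.sum_comm]
    refine Finset.sum_congr rfl fun i _ => ?_
    rw [Finset.sum_comm]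
    simp_rw [← Finset.mul_sum, S.φ_orthonormal]
    simp [pow_two]
  have hCS := Finset.sum_mul_sq_le_sq_mul_sq Finset.univ (fun i => S.σ i * S.ψ i x)
    (fun i => S.ψ i x)
  rw [hψ, hσ] at hCS
  have h2 : ∑ i, S.σ i * S.ψ i x ^ 2 = ∑ i, S.σ i * S.ψ i x * S.ψ i x :=
    Finset.sum_congr rfl fun i _ => by ring
  rw [h2]
  refine abs_le_of_sq_le_sq' ?_ hc |>.2
  refine hCS.trans (le_trans (le_of_eq ?_) (hM x))
  ring

open scoped MatrixOrder in
/-- For a positive semidefinite matrix `ξ` is read off the diagonal. -/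
theorem spectralRecoverability_le_of_posSemidef {n : ℕ} (hn : 0 < n)
    {M : Matrix (Fin n) (Fin n) ℝ} (hM : M.PosSemidef) {c : ℝ} (hc : ∀ x, n * M x x ≤ c) :
    spectralRecoverability (uniformWeight n) M ≤ c := by
  classical
  have hn' : (0 : ℝ) < n := by exact_mod_cast hn
  have hν : ∀ x, 0 < uniformWeight n x := fun x => by simp only [uniformWeight]; positivity
  have : Nonempty (Fin n) := ⟨⟨0, hn⟩⟩
  obtain ⟨S⟩ := WeightedSVD.nonempty hν M
  rw [spectralRecoverability_eq hν S]
  refine ciSup_le fun x => ?_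
  let U : Matrix (Fin n) (Fin n) ℝ := Matrix.of fun x i => S.ψ i x
  let V : Matrix (Fin n) (Fin n) ℝ := Matrix.of fun x i => S.φ i x
  let D : Matrix (Fin n) (Fin n) ℝ := Matrix.diagonal fun i => S.σ i / n
  have hD : D.transpose = D := Matrix.diagonal_transpose _
  have hU : U.transpose * U = (n : ℝ) • (1 : Matrix (Fin n) (Fin n) ℝ) := by
    ext i j
    rw [Matrix.mul_apply, Matrix.smul_apply, Matrix.one_apply, ← S.ψ_orthonormal i j, smul_eq_mul,
      Finset.mul_sum]
    refine Finset.sum_congr rfl fun x _ => ?_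
    simp only [Matrix.transpose_apply, Matrix.of_apply, uniformWeight, U]
    field_simp
  have hV : V.transpose * V = (n : ℝ) • (1 : Matrix (Fin n) (Fin n) ℝ) := by
    ext i j
    rw [Matrix.mul_apply, Matrix.smul_apply, Matrix.one_apply, ← S.φ_orthonormal i j, smul_eq_mul,
      Finset.mul_sum]
    refine Finset.sum_congr rfl fun x _ => ?_
    simp only [Matrix.transpose_apply, Matrix.of_apply, uniformWeight, V]
    field_simp
  have hMeq : M = U * D * V.transpose := by
    ext x y
    rw [S.eq_sum, Matrix.mul_apply]
    refine Finset.sum_congr rfl fun i _ => ?_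
    rw [Matrix.mul_diagonal]
    simp only [Matrix.transpose_apply, Matrix.of_apply, uniformWeight, U, V]
    ring
  have hKpos : (U * D * U.transpose).PosSemidef := by
    have := (Matrix.PosSemidef.diagonal (d := fun i => S.σ i / (n : ℝ))
      (fun i => div_nonneg (S.σ_nonneg i) hn'.le)).mul_mul_conjTranspose_same U
    simpa only [Matrix.conjTranspose_eq_transpose_of_trivial] using this
  -- Both squares equal `M * Mᵀ`, so uniqueness of the positive square root identifies `U * D * Uᵀ`,
  -- whose diagonal is the sum defining `ξ` divided by `n`, with `M`.
  have hKsq : (U * D * U.transpose) * (U * D * U.transpose) = M * M := by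
    have hMt : M.transpose = M := by
      rw [← Matrix.conjTranspose_eq_transpose_of_trivial]
      exact hM.isHermitian
    calc _ = U * D * (U.transpose * U) * D * U.transpose := by simp only [Matrix.mul_assoc]
      _ = U * D * (V.transpose * V) * D * U.transpose := by rw [hU, hV]
      _ = M * M.transpose := by
        rw [hMeq]
        simp only [Matrix.transpose_mul, Matrix.transpose_transpose, hD, Matrix.mul_assoc]
      _ = M * M := by rw [hMt]
  have hK : U * D * U.transpose = M := by
    rw [← CFC.sqrt_unique hKsq (Matrix.nonneg_iff_posSemidef.2 hKpos)]
    exact CFC.sqrt_unique rfl (Matrix.nonneg_iff_posSemidef.2 hM)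
  have hx := hc x
  rw [← hK, Matrix.mul_apply, Finset.mul_sum] at hx
  refine le_trans (le_of_eq ?_) hx
  refine Finset.sum_congr rfl fun i _ => ?_
  rw [Matrix.mul_diagonal]
  simp only [Matrix.transpose_apply, Matrix.of_apply, U]
  field_simp

/-! ### Paired perturbations of the uniform chain. -/

/-- The signs `±1`. -/
def boolSign (b : Bool) : ℝ := if b then 1 else -1

theorem abs_boolSign (b : Bool) : |boolSign b| = 1 := by
  cases b <;> simp [boolSign]

theorem boolSign_eq_or (b : Bool) : boolSign b = 1 ∨ boolSign b = -1 := by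
  cases b <;> simp [boolSign]

theorem boolSign_ne_iff (b c : Bool) : boolSign b ≠ boolSign c ↔ b ≠ c := by
  cases b <;> cases c <;> norm_num [boolSign]

/-- The kernel on `m` pairs of states and `r` further states which takes the values `± a i j`
between the `i`-th and the `j`-th pair, with opposite signs inside each pair. Its rows sum
to zero. -/
def pairedKernel {m : ℕ} (r : ℕ) (a : Matrix (Fin m) (Fin m) ℝ) :
    Matrix ((Fin m × Bool) ⊕ Fin r) ((Fin m × Bool) ⊕ Fin r) ℝ
  | .inl (i, s), .inl (j, t) => boolSign s * boolSign t * a i j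
  | _, _ => 0

/-- The perturbation `(1 + 3 ε B) / n` of the uniform chain, for a paired kernel `B`. -/
noncomputable def perturbedUniform {n m r : ℕ} (e : Fin n ≃ (Fin m × Bool) ⊕ Fin r) (ε : ℝ)
    (a : Matrix (Fin m) (Fin m) ℝ) : Matrix (Fin n) (Fin n) ℝ :=
  Matrix.of fun x y => (1 + 3 * ε * pairedKernel r a (e x) (e y)) / n

section

variable {n m r : ℕ} {a : Matrix (Fin m) (Fin m) ℝ}

theorem sum_pairedKernel (x : (Fin m × Bool) ⊕ Fin r) : ∑ y, pairedKernel r a x y = 0 := by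
  rcases x with ⟨i, s⟩ | k
  · simp [Fintype.sum_sum_type, Fintype.sum_prod_type, pairedKernel, boolSign]
  · simp [pairedKernel]

theorem pairedKernel_comm (ha : ∀ i j, a i j = a j i) (x y : (Fin m × Bool) ⊕ Fin r) :
    pairedKernel r a x y = pairedKernel r a y x := by
  rcases x with ⟨i, s⟩ | k <;> rcases y with ⟨j, t⟩ | l <;> simp only [pairedKernel]
  rw [ha i j, mul_comm (boolSign s)]

theorem abs_pairedKernel_le (ha : ∀ i j, a i j = 1 ∨ a i j = -1) (x y : (Fin m × Bool) ⊕ Fin r) :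
    |pairedKernel r a x y| ≤ 1 := by
  rcases x with ⟨i, s⟩ | k <;> rcases y with ⟨j, t⟩ | l <;> simp only [pairedKernel]
  · rw [abs_mul, abs_mul, abs_boolSign, abs_boolSign]
    rcases ha i j with h | h <;> simp [h]
  all_goals simp

/-- Each disagreement shows up in both columns of a pair, with a gap of `2` in each. -/
theorem sum_abs_pairedKernel_sub {b : Matrix (Fin m) (Fin m) ℝ}
    (ha : ∀ i j, a i j = 1 ∨ a i j = -1) (hb : ∀ i j, b i j = 1 ∨ b i j = -1) (i : Fin m)
    (s : Bool) :
    ∑ y, |pairedKernel r a (.inl (i, s)) y - pairedKernel r b (.inl (i, s)) y| =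
      4 * (Finset.univ.filter fun j => a i j ≠ b i j).card := by
  classical
  have h1 : ∀ j t, |boolSign s * boolSign t * a i j - boolSign s * boolSign t * b i j| =
      if a i j ≠ b i j then 2 else 0 := by
    intro j t
    rw [← mul_sub, abs_mul, abs_mul, abs_boolSign, abs_boolSign]
    rcases ha i j with h | h <;> rcases hb i j with h' | h' <;> norm_num [h, h']
  rw [Fintype.sum_sum_type, Fintype.sum_prod_type]
  simp only [pairedKernel, h1, sub_self, abs_zero, Finset.sum_const_zero, add_zero,
    Fintype.sum_bool]
  rw [Finset.sum_add_distrib, ← Finset.sum_filter,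
    Finset.sum_const, nsmul_eq_mul]
  ring

variable {e : Fin n ≃ (Fin m × Bool) ⊕ Fin r} {ε : ℝ}

theorem sum_perturbedUniform (hn : 0 < n) (x : Fin n) : ∑ y, perturbedUniform e ε a x y = 1 := by
  have hn' : (n : ℝ) ≠ 0 := by exact_mod_cast hn.ne'
  have h := e.sum_comp fun y => pairedKernel r a (e x) y
  rw [sum_pairedKernel] at h
  simp only [perturbedUniform, Matrix.of_apply]
  rw [← Finset.sum_div, Finset.sum_add_distrib, ← Finset.mul_sum, h]
  simp [hn']

theorem perturbedUniform_mem_rowStochastic (hn : 0 < n) (ha : ∀ i j, a i j = 1 ∨ a i j = -1)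
    (hε : 0 ≤ ε) (hε' : 3 * ε ≤ 1) :
    perturbedUniform e ε a ∈ Matrix.rowStochastic ℝ (Fin n) := by
  refine Matrix.mem_rowStochastic_iff_sum.2 ⟨fun x y => ?_, sum_perturbedUniform hn⟩
  have h := abs_le.1 (abs_pairedKernel_le (r := r) ha (e x) (e y))
  refine div_nonneg ?_ (Nat.cast_nonneg _)
  nlinarith

theorem perturbedUniform_comm (ha : ∀ i j, a i j = a j i) (x y : Fin n) :
    perturbedUniform e ε a x y = perturbedUniform e ε a y x := by
  simp only [perturbedUniform, Matrix.of_apply]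
  rw [pairedKernel_comm ha]

theorem isReversibleWeight_perturbedUniform (ha : ∀ i j, a i j = a j i) :
    IsReversibleWeight (uniformWeight n) (perturbedUniform e ε a) := by
  intro x y
  rw [perturbedUniform_comm ha x y]
  rfl

theorem isInvariantWeight_perturbedUniform (hn : 0 < n) (ha : ∀ i j, a i j = a j i) :
    IsInvariantWeight (uniformWeight n) (perturbedUniform e ε a) := by
  ext y
  simp only [Matrix.vecMul, dotProduct, uniformWeight]
  simp_rw [perturbedUniform_comm ha _ y]
  rw [← Finset.mul_sum, sum_perturbedUniform hn, mul_one]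

/-- The cross term vanishes because the kernel has zero row sums; this makes the information per
transition quadratic in `ε`. -/
theorem sum_perturbedUniform_sq_le (hn : 0 < n) (ha : ∀ i j, a i j = 1 ∨ a i j = -1) (x : Fin n) :
    ∑ y, perturbedUniform e ε a x y ^ 2 ≤ (1 + 9 * ε ^ 2) / n := by
  have hn' : (0 : ℝ) < n := by exact_mod_cast hn
  have h := e.sum_comp fun y => pairedKernel r a (e x) y
  rw [sum_pairedKernel] at h
  have h2 : ∑ y, pairedKernel r a (e x) (e y) ^ 2 ≤ n := by
    have : ∑ y, pairedKernel r a (e x) (e y) ^ 2 ≤ ∑ _y : Fin n, (1 : ℝ) :=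
      Finset.sum_le_sum fun y _ => (sq_le_one_iff_abs_le_one _).2 (abs_pairedKernel_le ha _ _)
    simpa using this
  have h3 : ∑ y, perturbedUniform e ε a x y ^ 2 =
      (n + 6 * ε * ∑ y, pairedKernel r a (e x) (e y) +
        9 * ε ^ 2 * ∑ y, pairedKernel r a (e x) (e y) ^ 2) / n ^ 2 := by
    have hcard : (n : ℝ) = ∑ _y : Fin n, (1 : ℝ) := by simp
    conv_rhs => enter [1, 1, 1]; rw [hcard]
    rw [Finset.mul_sum, Finset.mul_sum, ← Finset.sum_add_distrib, ← Finset.sum_add_distrib,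
      Finset.sum_div]
    refine Finset.sum_congr rfl fun y _ => ?_
    simp only [perturbedUniform, Matrix.of_apply]
    ring
  rw [h3, h, div_le_div_iff₀ (by positivity) hn']
  have := mul_le_mul_of_nonneg_left h2 (by positivity : 0 ≤ 9 * ε ^ 2)
  nlinarith

/-- By the triangle inequality the rows differ by at most `2ε`, and each disagreement costs `12ε/n`.
The factor `3` in the perturbation brings the radius `n/6` below the typical distance `m/2`. -/
theorem six_mul_card_le_of_inftyInftyNorm_le {b Q} (hn : 0 < n)
    (ha : ∀ i j, a i j = 1 ∨ a i j = -1) (hb : ∀ i j, b i j = 1 ∨ b i j = -1) (hε : 0 < ε)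
    (hQa : inftyInftyNorm (Q - perturbedUniform e ε a) ≤ ε)
    (hQb : inftyInftyNorm (Q - perturbedUniform e ε b) ≤ ε) (i : Fin m) :
    6 * ((Finset.univ.filter fun j => a i j ≠ b i j).card : ℝ) ≤ n := by
  have hn' : (0 : ℝ) < n := by exact_mod_cast hn
  have h1 := sum_abs_sub_le_of_inftyInftyNorm_le hε.le hQa hQb (e.symm (.inl (i, true)))
  have h2 := e.sum_comp fun y =>
    |pairedKernel r a (.inl (i, true)) y - pairedKernel r b (.inl (i, true)) y|
  rw [sum_abs_pairedKernel_sub ha hb] at h2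
  have h3 : ∀ y, |perturbedUniform e ε a (e.symm (.inl (i, true))) y -
      perturbedUniform e ε b (e.symm (.inl (i, true))) y| = 3 * ε / n *
        |pairedKernel r a (.inl (i, true)) (e y) - pairedKernel r b (.inl (i, true)) (e y)| := by
    intro y
    simp only [perturbedUniform, Matrix.of_apply, Equiv.apply_symm_apply]
    rw [← abs_of_nonneg (by positivity : 0 ≤ 3 * ε / n), ← abs_mul]
    congr 1
    ring
  simp_rw [h3] at h1
  rw [← Finset.mul_sum, h2, div_mul_eq_mul_div, div_le_iff₀ hn'] at h1
  refine le_of_mul_le_mul_left ?_ (by positivity : 0 < 2 * ε)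
  linarith

end

/-! ### From separation to a lower bound. -/

/-- No estimator identifies a large well separated family of perturbations of the uniform chain
from few transitions. -/
theorem not_exists_isPACEstimator_of_separated {n m r : ℕ} (hn : 0 < n)
    (e : Fin n ≃ (Fin m × Bool) ⊕ Fin r) {H : Type*} [Fintype H] [Nonempty H]
    (a : H → Matrix (Fin m) (Fin m) ℝ) (ha : ∀ h i j, a h i j = 1 ∨ a h i j = -1)
    {ε δ p : ℝ} (hε : 0 < ε) (hε' : 3 * ε ≤ 1) (hδ : δ ≤ 1 / 2)
    (hp : ∀ h₀, ∀ B : Finset H,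
      (∀ h ∈ B, ∀ i, 6 * ((Finset.univ.filter fun j => a h i j ≠ a h₀ i j).card : ℝ) ≤ n) →
      (B.card : ℝ) ≤ p * Fintype.card H)
    {Z : Fin n → ℕ} (hZ : Real.exp (9 * ε ^ 2 * ∑ x, (Z x : ℝ)) * p < 1 / 4)
    {Pc : Set (Matrix (Fin n) (Fin n) ℝ)} (hPc : ∀ h, perturbedUniform e ε (a h) ∈ Pc) :
    ¬ ∃ est : TransitionSample n Z → Matrix (Fin n) (Fin n) ℝ,
      IsPACEstimator Pc id inftyInftyNorm Z ε δ est := by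
  classical
  rintro ⟨est, hest⟩
  have : Nonempty (Fin n) := ⟨⟨0, hn⟩⟩
  have hH : (0 : ℝ) < Fintype.card H := by exact_mod_cast Fintype.card_pos
  let A : H → Finset (TransitionSample n Z) := fun h =>
    Finset.univ.filter fun ω => inftyInftyNorm (est ω - perturbedUniform e ε (a h)) ≤ ε
  have hmem : ∀ h ω, ω ∈ A h ↔ inftyInftyNorm (est ω - perturbedUniform e ε (a h)) ≤ ε := by
    simp [A]
  have hlow : ∀ h, 1 / 2 ≤ ∑ ω ∈ A h, ∏ s, perturbedUniform e ε (a h) s.1 (ω s) := fun h =>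
    hest.half_le_sum hδ (hPc h) (perturbedUniform_mem_rowStochastic hn (ha h) hε.le hε') (hmem h)
  have hup := sq_sum_le_of_chiSq
    (fun h (s : Σ x : Fin n, Fin (Z x)) y => perturbedUniform e ε (a h) s.1 y) A
    (c := 9 * ε ^ 2) (p := p) ?_ ?_
  · have hsum : (Fintype.card H : ℝ) / 2 ≤
        ∑ h, ∑ ω ∈ A h, ∏ s, perturbedUniform e ε (a h) s.1 (ω s) := by
      have := Finset.sum_le_sum fun h (_ : h ∈ Finset.univ) => hlow h
      simp only [Finset.sum_const, Finset.card_univ, nsmul_eq_mul] at this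
      linarith
    have hsq := pow_le_pow_left₀ (by positivity) hsum 2
    have hcard : (Fintype.card (Σ x : Fin n, Fin (Z x)) : ℝ) = ∑ x, (Z x : ℝ) := by simp
    rw [hcard] at hup
    have := mul_lt_mul_of_pos_right hZ (pow_pos hH 2)
    linarith
  · intro h s
    refine (sum_perturbedUniform_sq_le hn (ha h) s.1).trans ?_
    rw [Fintype.card_fin]
    gcongr
    linarith [Real.add_one_le_exp (9 * ε ^ 2)]
  -- All hypotheses in `B` are close to the same `est ω`, so any member of `B` can serve as the
  -- centre.
  · intro ω B hB
    rcases B.eq_empty_or_nonempty with rfl | ⟨h₀, h₀B⟩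
    · exact hp (Classical.arbitrary H) ∅ (by simp)
    · exact hp h₀ B fun h hh i => six_mul_card_le_of_inftyInftyNorm_le hn (ha h) (ha h₀) hε
        ((hmem h ω).1 (hB h hh)) ((hmem h₀ ω).1 (hB h₀ h₀B)) i

/-! ### The rank one family, for small `κ`. -/

/-- The rank one sign matrix `u uᵀ` of a sign vector `u`. -/
def rankOneSigns {m : ℕ} (h : Fin m → Bool) : Matrix (Fin m) (Fin m) ℝ :=
  Matrix.of fun i j => boolSign (h i) * boolSign (h j)

theorem rankOneSigns_eq_or {m : ℕ} (h : Fin m → Bool) (i j : Fin m) :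
    rankOneSigns h i j = 1 ∨ rankOneSigns h i j = -1 := by
  simp only [rankOneSigns, Matrix.of_apply]
  cases h i <;> cases h j <;> simp [boolSign]

theorem rankOneSigns_comm {m : ℕ} (h : Fin m → Bool) (i j : Fin m) :
    rankOneSigns h i j = rankOneSigns h j i := by
  simp only [rankOneSigns, Matrix.of_apply, mul_comm]

/-- A single row determines the sign vector up to a global sign. Hence `B` is covered by the Hamming
balls around `h₀` and its complement, which explains the factor `2`. -/
theorem card_rankOneSigns_close_le {m n : ℕ} (hm : 0 < m) (h₀ : Fin m → Bool)
    (B : Finset (Fin m → Bool))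
    (hB : ∀ h ∈ B, ∀ i, 6 * ((Finset.univ.filter fun j =>
      rankOneSigns h i j ≠ rankOneSigns h₀ i j).card : ℝ) ≤ n) :
    (B.card : ℝ) ≤
      2 * Real.exp (n / 6 * (7 / 10) - m / 4) * Fintype.card (Fin m → Bool) := by
  let o : Fin m := ⟨0, hm⟩
  have h1 := card_hamming_ball_le h₀ (B.filter fun h => h o = h₀ o) (t := n / 6) (by
    intro h hh
    obtain ⟨hhB, ho⟩ := Finset.mem_filter.1 hh
    have := hB h hhB o
    have he : ∀ j, rankOneSigns h o j ≠ rankOneSigns h₀ o j ↔ h j ≠ h₀ j := by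
      intro j
      simp only [rankOneSigns, Matrix.of_apply, ho]
      cases h₀ o <;> cases h j <;> cases h₀ j <;> norm_num [boolSign]
    simp only [he] at this
    linarith)
  have h2 := card_hamming_ball_le (fun i => !h₀ i) (B.filter fun h => ¬ h o = h₀ o) (t := n / 6) (by
    intro h hh
    obtain ⟨hhB, ho⟩ := Finset.mem_filter.1 hh
    have := hB h hhB o
    have ho' : h o = !h₀ o := by
      revert ho
      cases h o <;> cases h₀ o <;> simp
    have he : ∀ j, rankOneSigns h o j ≠ rankOneSigns h₀ o j ↔ h j ≠ !h₀ j := by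
      intro j
      simp only [rankOneSigns, Matrix.of_apply, ho']
      cases h₀ o <;> cases h j <;> cases h₀ j <;> norm_num [boolSign]
    simp only [he] at this
    linarith)
  have h3 : ((B.filter fun h => h o = h₀ o).card : ℝ) + (B.filter fun h => ¬ h o = h₀ o).card =
      B.card := by
    exact_mod_cast Finset.card_filter_add_card_filter_not (s := B) (fun h => h o = h₀ o)
  rw [Fintype.card_fin] at h1 h2
  linarith

/-- The chain is `(11ᵀ + 3ε wwᵀ)/n`, where `w` is the sign vector extended to pairs and by zero. -/
theorem posSemidef_perturbedUniform_rankOneSigns {n m r : ℕ} (e : Fin n ≃ (Fin m × Bool) ⊕ Fin r)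
    {ε : ℝ} (hε : 0 ≤ ε) (h : Fin m → Bool) :
    (perturbedUniform e ε (rankOneSigns h)).PosSemidef := by
  let w : (Fin m × Bool) ⊕ Fin r → ℝ := Sum.elim (fun q => boolSign q.2 * boolSign (h q.1)) 0
  have hk : ∀ x y, pairedKernel r (rankOneSigns h) x y = w x * w y := by
    rintro (⟨i, s⟩ | k) (⟨j, t⟩ | l) <;> simp [pairedKernel, w, rankOneSigns]
    ring
  have heq : perturbedUniform e ε (rankOneSigns h) =
      (1 / (n : ℝ)) • (Matrix.vecMulVec 1 (star 1) +
        (3 * ε) • Matrix.vecMulVec (fun x => w (e x)) (star fun x => w (e x))) := by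
    ext x y
    simp only [perturbedUniform, Matrix.of_apply, hk, Matrix.smul_apply, Matrix.add_apply,
      Matrix.vecMulVec_apply, Pi.one_apply, star_trivial, smul_eq_mul, mul_one]
    ring
  rw [heq]
  exact ((Matrix.posSemidef_vecMulVec_self_star _).add
    ((Matrix.posSemidef_vecMulVec_self_star _).smul (by positivity))).smul (by positivity)

/-- Positivity reduces `ξ` to diagonal entries; the second-moment bound would only give order `√n`,
too weak for small `κ`. -/
theorem spectralRecoverability_perturbedUniform_rankOneSigns_le {n m r : ℕ} (hn : 0 < n)
    (e : Fin n ≃ (Fin m × Bool) ⊕ Fin r) {ε : ℝ} (hε : 0 ≤ ε) (h : Fin m → Bool) :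
    spectralRecoverability (uniformWeight n) (perturbedUniform e ε (rankOneSigns h)) ≤
      1 + 3 * ε := by
  have hn' : (n : ℝ) ≠ 0 := by exact_mod_cast hn.ne'
  refine spectralRecoverability_le_of_posSemidef hn
    (posSemidef_perturbedUniform_rankOneSigns e hε h) fun x => ?_
  have := (abs_le.1 (abs_pairedKernel_le (r := r) (rankOneSigns_eq_or h) (e x) (e x))).2
  simp only [perturbedUniform, Matrix.of_apply]
  rw [mul_div_cancel₀ _ hn']
  nlinarith

/-! ### The full symmetric family, for large `κ`. -/

/-- The symmetric sign matrix with prescribed entries above the diagonal and `1` on it. -/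
def symmetricSigns {m : ℕ} (h : {q : Fin m × Fin m // q.1 < q.2} → Bool) :
    Matrix (Fin m) (Fin m) ℝ :=
  Matrix.of fun i j => if hij : i < j then boolSign (h ⟨(i, j), hij⟩)
    else if hji : j < i then boolSign (h ⟨(j, i), hji⟩) else 1

section

variable {m : ℕ} (h : {q : Fin m × Fin m // q.1 < q.2} → Bool)

theorem symmetricSigns_eq_or (i j : Fin m) :
    symmetricSigns h i j = 1 ∨ symmetricSigns h i j = -1 := by
  simp only [symmetricSigns, Matrix.of_apply]
  split_ifs
  · exact boolSign_eq_or _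
  · exact boolSign_eq_or _
  · exact Or.inl rfl

theorem symmetricSigns_comm (i j : Fin m) : symmetricSigns h i j = symmetricSigns h j i := by
  simp only [symmetricSigns, Matrix.of_apply]
  rcases lt_trichotomy i j with hij | rfl | hij
  · simp [hij, hij.not_gt]
  · rfl
  · simp [hij, hij.not_gt]

theorem symmetricSigns_of_lt {i j : Fin m} (hij : i < j) :
    symmetricSigns h i j = boolSign (h ⟨(i, j), hij⟩) := by
  simp [symmetricSigns, hij]

end

theorem card_filter_prod_of_symm {α : Type*} [Fintype α] [LinearOrder α] (R : α → α → Prop)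
    [∀ i j, Decidable (R i j)] (hR : ∀ i j, R i j → R j i) :
    (Finset.univ.filter fun q : α × α => R q.1 q.2).card =
      2 * (Finset.univ.filter fun q : α × α => q.1 < q.2 ∧ R q.1 q.2).card +
        (Finset.univ.filter fun i => R i i).card := by
  simp only [Finset.card_filter, Fintype.sum_prod_type]
  have h1 : ∀ i j, (if R i j then 1 else 0) = (if i < j ∧ R i j then 1 else 0) +
      (if j < i ∧ R j i then 1 else 0) + (if j = i then (if R j j then 1 else 0) else 0) := by
    intro i j
    have hs : R i j ↔ R j i := ⟨hR i j, hR j i⟩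
    rcases lt_trichotomy i j with hij | rfl | hij
    · simp [hij, hij.not_gt, hij.ne']
    · simp
    · rw [if_congr hs rfl rfl]
      simp [hij, hij.not_gt, hij.ne]
  rw [Finset.sum_congr rfl fun i _ => Finset.sum_congr rfl fun j _ => h1 i j]
  simp_rw [Finset.sum_add_distrib]
  rw [Finset.sum_comm (f := fun i j => if j < i ∧ R j i then 1 else 0)]
  simp
  ring

/-- Summing the row constraints allows `mn/6` disagreements in all. Each free bit is seen twice, so
the bits lie in a Hamming ball of radius `mn/12` among `(m² - m)/2` bits. -/
theorem card_symmetricSigns_close_le {m n : ℕ} (h₀ : {q : Fin m × Fin m // q.1 < q.2} → Bool)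
    (B : Finset ({q : Fin m × Fin m // q.1 < q.2} → Bool))
    (hB : ∀ h ∈ B, ∀ i, 6 * ((Finset.univ.filter fun j =>
      symmetricSigns h i j ≠ symmetricSigns h₀ i j).card : ℝ) ≤ n) :
    (B.card : ℝ) ≤ Real.exp (m * n / 12 * (7 / 10) - (m ^ 2 - m) / 8) *
      Fintype.card ({q : Fin m × Fin m // q.1 < q.2} → Bool) := by
  classical
  have hcard : (Fintype.card {q : Fin m × Fin m // q.1 < q.2} : ℝ) = (m ^ 2 - m) / 2 := by
    have := card_filter_prod_of_symm (fun _ _ : Fin m => True) (fun _ _ h => h)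
    simp only [Finset.filter_true, and_true, Finset.card_univ, Fintype.card_prod, Fintype.card_fin,
      ← Fintype.card_subtype] at this
    have h' : (m : ℝ) * m = 2 * (Fintype.card {q : Fin m × Fin m // q.1 < q.2} : ℝ) + m := by
      exact_mod_cast this
    linarith
  refine (card_hamming_ball_le h₀ B (t := m * n / 12) fun h hh => ?_).trans (le_of_eq ?_)
  · have h1 := card_filter_prod_of_symm
      (fun i j : Fin m => symmetricSigns h i j ≠ symmetricSigns h₀ i j)
      (fun i j => by rw [symmetricSigns_comm h, symmetricSigns_comm h₀]; exact id)
    have h2 : (Finset.univ.filter fun q => h q ≠ h₀ q).card ≤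
        (Finset.univ.filter fun q : Fin m × Fin m =>
          q.1 < q.2 ∧ symmetricSigns h q.1 q.2 ≠ symmetricSigns h₀ q.1 q.2).card := by
      refine Finset.card_le_card_of_injOn Subtype.val ?_ Subtype.val_injective.injOn
      rintro ⟨q, hq⟩ hne
      have hne' : h ⟨q, hq⟩ ≠ h₀ ⟨q, hq⟩ := by simpa using hne
      simp only [Finset.coe_filter, Finset.mem_univ, true_and, Set.mem_ofPred_eq]
      refine ⟨hq, ?_⟩
      rw [symmetricSigns_of_lt _ hq, symmetricSigns_of_lt _ hq, boolSign_ne_iff]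
      exact hne'
    have h3 : (Finset.univ.filter fun q : Fin m × Fin m =>
        symmetricSigns h q.1 q.2 ≠ symmetricSigns h₀ q.1 q.2).card =
        ∑ i, (Finset.univ.filter fun j => symmetricSigns h i j ≠ symmetricSigns h₀ i j).card := by
      simp only [Finset.card_filter, Fintype.sum_prod_type]
    have h4 : 6 * ∑ i, ((Finset.univ.filter fun j =>
        symmetricSigns h i j ≠ symmetricSigns h₀ i j).card : ℝ) ≤ m * n := by
      rw [Finset.mul_sum]
      refine (Finset.sum_le_sum fun i _ => hB h hh i).trans ?_
      simp
    have h5 : 2 * (Finset.univ.filter fun q => h q ≠ h₀ q).card ≤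
        ∑ i, (Finset.univ.filter fun j => symmetricSigns h i j ≠ symmetricSigns h₀ i j).card := by
      omega
    have h6 : 2 * ((Finset.univ.filter fun q => h q ≠ h₀ q).card : ℝ) ≤
        ∑ i, ((Finset.univ.filter fun j =>
          symmetricSigns h i j ≠ symmetricSigns h₀ i j).card : ℝ) := by
      exact_mod_cast h5
    linarith
  · rw [hcard]
    congr 2
    ring

/-! ### Choice of constants and conclusion. -/

theorem exp_lt_one_div_eight {x : ℝ} (hx : x ≤ -7.5) : Real.exp x < 1 / 8 := by
  have h := Real.add_one_le_exp (-x)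
  rw [Real.exp_neg] at h
  have hpos := Real.exp_pos x
  rw [lt_div_iff₀ (by norm_num)]
  have h2 : (8.5 : ℝ) ≤ (Real.exp x)⁻¹ := by linarith
  rw [le_inv_comm₀ (by norm_num) hpos] at h2
  norm_num at h2
  linarith

theorem mainTheorem8 :
    ∃ C : ℝ, 0 < C ∧ ∃ n₀ : ℕ, ∀ n : ℕ, n₀ ≤ n → ∀ κ : ℝ, 1 ≤ κ → κ ≤ n →
      ∃ Pc : Set (Matrix (Fin n) (Fin n) ℝ),
        (∀ P ∈ Pc, P ∈ Matrix.rowStochastic ℝ (Fin n) ∧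
          IsReversibleWeight (uniformWeight n) P ∧ IsInvariantWeight (uniformWeight n) P) ∧
        (∀ P ∈ Pc, spectralRecoverability (uniformWeight n) P ≤ κ) ∧
        ∀ ε : ℝ, 0 < ε → ε < 1 / 3 → 3 * ε ≤ κ - 1 →
          ∀ δ : ℝ, 0 ≤ δ → δ ≤ 1 / 2 →
            ∀ Z : Fin n → ℕ, (∑ x, (Z x : ℝ)) ≤ C * (ε ^ 2)⁻¹ * max (n : ℝ) (κ ^ 2) →
              ¬ ∃ est : TransitionSample n Z → Matrix (Fin n) (Fin n) ℝ,
                IsPACEstimator Pc id inftyInftyNorm Z ε δ est := by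
  -- In the rank one case the exponent is at most about `1/8 - (1/8 - 7/60 - 18/100000) n`, roughly
  -- `-8` at `n = 1000`, just under the required `-7.5`.
  refine ⟨1 / 100000, by norm_num, 1000, fun n hn₀ κ hκ hκn => ?_⟩
  have hn : 0 < n := by omega
  have hn₀' : (1000 : ℝ) ≤ n := by exact_mod_cast hn₀
  obtain ⟨m, r, hr, hnm⟩ : ∃ m r : ℕ, r ≤ 1 ∧ n = 2 * m + r := ⟨n / 2, n % 2, by omega, by omega⟩
  have hm : 0 < m := by omega
  have hm₁ : (n : ℝ) ≤ 2 * m + 1 := by exact_mod_cast (by omega : n ≤ 2 * m + 1)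
  have hm₂ : (499 : ℝ) ≤ m := by exact_mod_cast (by omega : 499 ≤ m)
  have e : Fin n ≃ (Fin m × Bool) ⊕ Fin r := Fintype.equivOfCardEq (by simp; omega)
  -- The family consists of all admissible chains, so it does not depend on `ε`; the hypotheses used
  -- against an estimator are chosen inside it afterwards.
  refine ⟨{P | (P ∈ Matrix.rowStochastic ℝ (Fin n) ∧ IsReversibleWeight (uniformWeight n) P ∧
    IsInvariantWeight (uniformWeight n) P) ∧ spectralRecoverability (uniformWeight n) P ≤ κ},
    fun P hP => hP.1, fun P hP => hP.2, fun ε hε hε' hεκ δ _ hδ Z hZ => ?_⟩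
  have hε3 : 3 * ε ≤ 1 := by linarith
  have hZ' : ε ^ 2 * ∑ x, (Z x : ℝ) ≤ 1 / 100000 * max (n : ℝ) (κ ^ 2) := by
    refine (mul_le_mul_of_nonneg_left hZ (sq_nonneg ε)).trans (le_of_eq ?_)
    field_simp
  rcases le_or_gt (2 * (n : ℝ)) (κ ^ 2) with hκ2 | hκ2
  -- Here `κ ≤ n ≤ 2m + 1 ≤ 3m`.
  · have hmax : max (n : ℝ) (κ ^ 2) ≤ 9 * m ^ 2 := by
      refine max_le (by nlinarith) ?_
      nlinarith
    refine not_exists_isPACEstimator_of_separated hn e symmetricSigns symmetricSigns_eq_or hε hε3 hδ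
      card_symmetricSigns_close_le ?_ fun h => ?_
    · rw [← Real.exp_add]
      refine (exp_lt_one_div_eight ?_).trans (by norm_num)
      have : (m : ℝ) * n ≤ m * (2 * m + 1) := by gcongr
      nlinarith
    · refine ⟨⟨perturbedUniform_mem_rowStochastic hn (symmetricSigns_eq_or h) hε.le hε3,
        isReversibleWeight_perturbedUniform (symmetricSigns_comm h),
        isInvariantWeight_perturbedUniform hn (symmetricSigns_comm h)⟩,
        spectralRecoverability_le_of_sum_sq_le hn (by linarith) fun x => ?_⟩
      have h1 := sum_perturbedUniform_sq_le (e := e) (ε := ε) hn (symmetricSigns_eq_or h) x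
      rw [le_div_iff₀ (by linarith)] at h1
      -- Since `3ε ≤ 1`, the second moment bound is at most `2n ≤ κ²`; this fixes the threshold of
      -- the case split.
      have h2 : (n : ℝ) * (1 + 9 * ε ^ 2) ≤ n * 2 := by
        gcongr
        nlinarith
      nlinarith
  · have hmax : max (n : ℝ) (κ ^ 2) ≤ 2 * n := max_le (by linarith) hκ2.le
    refine not_exists_isPACEstimator_of_separated hn e rankOneSigns rankOneSigns_eq_or hε hε3 hδ
      (card_rankOneSigns_close_le hm) ?_ fun h => ?_
    · rw [mul_left_comm, ← Real.exp_add]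
      have := exp_lt_one_div_eight (x := 9 * ε ^ 2 * ∑ x, (Z x : ℝ) +
        (n / 6 * (7 / 10) - m / 4)) (by linarith)
      linarith
    · exact ⟨⟨perturbedUniform_mem_rowStochastic hn (rankOneSigns_eq_or h) hε.le hε3,
        isReversibleWeight_perturbedUniform (rankOneSigns_comm h),
        isInvariantWeight_perturbedUniform hn (rankOneSigns_comm h)⟩,
        -- This is where `3ε ≤ κ - 1` is needed.
        (spectralRecoverability_perturbedUniform_rankOneSigns_le hn e hε.le h).trans
          (by linarith)⟩
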